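/- Let $\mathcal K$ be a complex Hilbert space (of any dimension) and let $\mathcal B_2(\mathcal K)$ be the Hilbert space of Hilbert–Schmidt operators on $\mathcal K$ with the inner product $\langle A,B\rangle_2=\operatorname{tr}(A^\dagger B)$. Let $\rho,\sigma$ be states on $\mathcal K$, i.e. positive trace class operators of trace one (not necessarily faithful), with spectral decompositions $$\rho=\sum_{i\in\mathcal I}r_i|u_i\rangle\langle u_i|,\qquad \sigma=\sum_{j\in\mathcal I}s_j|v_j\rangle\langle v_j|,$$ where $r_i,s_j\ge 0$, $\sum_i r_i=\sum_j s_j=1$, and $\{u_i\}_{i\in\mathcal I}$, $\{v_j\}_{j\in\mathcal I}$ are orthonormal bases of $\mathcal K$. Let $\Pi_\sigma$ be the orthogonal projection onto the support $(\ker\sigma)^\perp$ of $\sigma$, and let $S$ be the densely defined, closable antilinear operator on $\mathcal B_2(\mathcal K)$ with domain $$D(S)=\{X\sqrt\sigma: X\in\mathcal B(\mathcal K)\}+\{Y(I-\Pi_\sigma): Y\in\mathcal B_2(\mathcal K)\},\qquad S\bigl(X\sqrt\sigma+Y(I-\Pi_\sigma)\bigr)=\Pi_\sigma X^\dagger\sqrt\rho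 .$$ Let $\overline S$ be its closure, let $S^\dagger$ be its adjoint (so $S^\dagger a=c$ means $\langle a,Sb\rangle_2=\overline{\langle c,b\rangle_2}$ for all $b\in D(S)$), and let $\Delta_{\rho,\sigma}=S^\dagger\overline S$ be the relative modular operator. Put $X_{ij}=|u_i\rangle\langle v_j|$. Then: 1. $\{X_{ij}\}_{i,j\in\mathcal I}$ is an orthonormal basis of $\mathcal B_2(\mathcal K)$. 2. $\Delta_{\rho,\sigma}=\sum_{\{i,j:\,r_i\ne0,\,s_j\ne0\}}r_is_j^{-1}|X_{ij}\rangle\langle X_{ij}|$; that is, the domain of $\Delta_{\rho,\sigma}$ is the set of all $A\in\mathcal B_2(\mathcal K)$ with $\sum_{\{i,j:\,r_i\ne0,\,s_j\ne0\}}(r_i/s_j)^2|\langle X_{ij},A\rangle_2|^2<\infty$, and for such $A$ $$\Delta_{\rho,\sigma}A=\sum_{\{i,j:\,r_i\ne0,\,s_j\ne0\}}\frac{r_i}{s_j}\,\langle X_{ij},A\rangle_2\,X_{ij}\quad\text{in }\mathcal B_2(\mathcal K).$$ In particular $\Delta_{\rho,\sigma}X_{ij}=r_is_j^{-1}X_{ij}$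 whenever $r_i\neq0$ and $s_j\ne0$. 3. $\ker\Delta_{\rho,\sigma}=\overline{\operatorname{span}}\{X_{ij}: r_i=0\text{ or }s_j=0\}$. -/

import Mathlib

noncomputable section

open scoped ComplexConjugate ENNReal

set_option linter.unusedSectionVars false

namespace RelMod

universe u

variable (K : Type u) [NormedAddCommGroup K] [InnerProductSpace ℂ K] [CompleteSpace K]

/-! ### Hilbert–Schmidt operators -/

/-- The index set of a fixed orthonormal (Hilbert) basis of `K`. -/
def refIndex : Set K := (exists_hilbertBasis ℂ K).choose

/-- A fixed orthonormal (Hilbert) basis of `K`, used to write down traces. By `isHS_iff`,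
`HS.hasSum_inner` and `DensityOperator.hasSum_trace` below nothing depends on this choice. -/
def refBasis : HilbertBasis (refIndex K) ℂ K := (exists_hilbertBasis ℂ K).choose_spec.choose

variable {K}

/-- `A` is Hilbert–Schmidt: `∑ i, ‖A eᵢ‖² < ∞`. -/
def IsHS (A : K →L[ℂ] K) : Prop := Summable fun i => ‖A (refBasis K i)‖ ^ 2

theorem hasSum_norm_inner_sq {ι : Type*} (b : HilbertBasis ι ℂ K) (x : K) :
    HasSum (fun i => ‖inner ℂ (b i) x‖ ^ 2) (‖x‖ ^ 2) := by
  have h := b.hasSum_inner_mul_inner x x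
  have h2 : (fun i => inner ℂ x (b i) * inner ℂ (b i) x)
      = fun i => ((‖inner ℂ (b i) x‖ ^ 2 : ℝ) : ℂ) := by
    funext i
    rw [← inner_conj_symm x (b i), Complex.conj_mul']
    push_cast; rfl
  have h3 : inner ℂ x x = ((‖x‖ ^ 2 : ℝ) : ℂ) := by
    rw [inner_self_eq_norm_sq_to_K]; push_cast; rfl
  rw [h2, h3] at h
  exact Complex.hasSum_ofReal.1 h

theorem tsum_enorm_inner_sq {ι : Type*} (b : HilbertBasis ι ℂ K) (x : K) :
    ∑' i, ‖inner ℂ (b i) x‖ₑ ^ 2 = ‖x‖ₑ ^ 2 := by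
  have h := hasSum_norm_inner_sq b x
  have h3 := ENNReal.ofReal_tsum_of_nonneg (fun i => by positivity) h.summable
  rw [h.tsum_eq] at h3
  simpa [ENNReal.ofReal_pow, ofReal_norm] using h3.symm

theorem tsum_enorm_sq_adjoint {ι κ : Type*} (b : HilbertBasis ι ℂ K) (c : HilbertBasis κ ℂ K)
    (A : K →L[ℂ] K) :
    ∑' i, ‖A (b i)‖ₑ ^ 2 = ∑' k, ‖A.adjoint (c k)‖ₑ ^ 2 := by
  simp_rw [← tsum_enorm_inner_sq c (A _), ← tsum_enorm_inner_sq b (A.adjoint _)]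
  rw [ENNReal.tsum_comm]
  refine tsum_congr fun k => tsum_congr fun i => ?_
  rw [ContinuousLinearMap.adjoint_inner_right, ← ofReal_norm, ← ofReal_norm, norm_inner_symm]

theorem summable_sq_iff {ι : Type*} (f : ι → K) :
    (Summable fun i => ‖f i‖ ^ 2) ↔ ∑' i, ‖f i‖ₑ ^ 2 ≠ ∞ := by
  have h : (fun i => ‖f i‖ₑ ^ 2) = fun i => ((‖f i‖₊ ^ 2 : NNReal) : ℝ≥0∞) := by
    funext i; simp [enorm_eq_nnnorm]
  rw [h, ENNReal.tsum_coe_ne_top_iff_summable, ← NNReal.summable_coe]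
  simp

/-- Being Hilbert–Schmidt does not depend on the orthonormal basis. -/
theorem isHS_iff {ι : Type*} (b : HilbertBasis ι ℂ K) (A : K →L[ℂ] K) :
    IsHS A ↔ Summable fun i => ‖A (b i)‖ ^ 2 := by
  rw [IsHS, summable_sq_iff, summable_sq_iff, tsum_enorm_sq_adjoint (refBasis K) (refBasis K),
    tsum_enorm_sq_adjoint b (refBasis K)]

theorem IsHS.adjoint {A : K →L[ℂ] K} (hA : IsHS A) : IsHS A.adjoint := by
  rw [IsHS, summable_sq_iff] at *
  rwa [← tsum_enorm_sq_adjoint (refBasis K) (refBasis K)]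

theorem IsHS.mul_left {A : K →L[ℂ] K} (hA : IsHS A) (X : K →L[ℂ] K) : IsHS (X * A) := by
  refine Summable.of_nonneg_of_le (fun i => by positivity) (fun i => ?_)
    (Summable.mul_left (‖X‖ ^ 2) hA)
  rw [← mul_pow]
  gcongr
  exact X.le_opNorm _

theorem IsHS.mul_right {A : K →L[ℂ] K} (hA : IsHS A) (X : K →L[ℂ] K) : IsHS (A * X) := by
  have h := (hA.adjoint.mul_left X.adjoint).adjoint
  rwa [ContinuousLinearMap.mul_def, ContinuousLinearMap.adjoint_comp,
    ContinuousLinearMap.adjoint_adjoint, ContinuousLinearMap.adjoint_adjoint] at h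

theorem isHS_memℓp (A : K →L[ℂ] K) :
    IsHS A ↔ Memℓp (fun i => A (refBasis K i)) 2 := by
  rw [memℓp_gen_iff (by norm_num)]
  simp [IsHS]

variable (K)

/-- The linear space of Hilbert–Schmidt operators. -/
def hsSubmodule : Submodule ℂ (K →L[ℂ] K) where
  carrier := {A | IsHS A}
  zero_mem' := by simp [IsHS]
  add_mem' {A B} hA hB := by
    simp only [Set.mem_ofPred_eq, isHS_memℓp] at *
    exact hA.add hB
  smul_mem' c A hA := by
    simp only [Set.mem_ofPred_eq, isHS_memℓp] at *
    exact hA.const_smul c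

/-- The space of Hilbert–Schmidt operators on `K`. This is a type synonym, so that it carries the
Hilbert–Schmidt norm defined below and not the operator norm. -/
def HS : Type u := ↥(hsSubmodule K)

instance : AddCommGroup (HS K) := inferInstanceAs (AddCommGroup ↥(hsSubmodule K))
instance : Module ℂ (HS K) := inferInstanceAs (Module ℂ ↥(hsSubmodule K))

variable {K}

namespace HS

/-- The underlying bounded operator, as a linear map. -/
def op : HS K →ₗ[ℂ] (K →L[ℂ] K) := (hsSubmodule K).subtype

/-- A Hilbert–Schmidt operator as an element of `HS K`. -/
def mk (A : K →L[ℂ] K) (hA : IsHS A) : HS K := ⟨A, hA⟩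

@[simp] theorem op_mk (A : K →L[ℂ] K) (hA : IsHS A) : (mk A hA).op = A := rfl

theorem isHS (A : HS K) : IsHS A.op := A.2

@[ext] theorem ext {A B : HS K} (h : A.op = B.op) : A = B := Subtype.ext h

/-- The columns `A eᵢ`, as an element of `ℓ²`. -/
def toLp : HS K →ₗ[ℂ] lp (fun _ : refIndex K => K) 2 where
  toFun A := ⟨fun i => A.op (refBasis K i), (isHS_memℓp _).1 A.isHS⟩
  map_add' A B := by ext i; simp; rfl
  map_smul' c A := by ext i; simp

@[simp] theorem toLp_apply (A : HS K) (i : refIndex K) : toLp A i = A.op (refBasis K i) := rfl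

theorem toLp_injective : Function.Injective (toLp : HS K →ₗ[ℂ] _) := by
  intro A B h
  ext1
  refine ContinuousLinearMap.ext_on
    (Submodule.dense_iff_topologicalClosure_eq_top.2 (refBasis K).dense_span) ?_
  rintro _ ⟨i, rfl⟩
  rw [← toLp_apply, ← toLp_apply, h]

/-- The inner product `⟨A, B⟩₂ = tr (A† B) = ∑ i, ⟨A eᵢ, B eᵢ⟩`. -/
instance : Inner ℂ (HS K) := ⟨fun A B => ∑' i, inner ℂ (A.op (refBasis K i)) (B.op (refBasis K i))⟩

theorem inner_def (A B : HS K) :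
    inner ℂ A B = ∑' i, inner ℂ (A.op (refBasis K i)) (B.op (refBasis K i)) := rfl

theorem inner_eq_toLp (A B : HS K) : inner ℂ A B = inner ℂ (toLp A) (toLp B) := by
  rw [lp.inner_eq_tsum, inner_def]; rfl

@[reducible] def core : InnerProductSpace.Core ℂ (HS K) where
  inner A B := inner ℂ A B
  conj_inner_symm A B := by simp only [inner_eq_toLp, inner_conj_symm]
  re_inner_nonneg A := by rw [inner_eq_toLp]; exact inner_self_nonneg
  add_left A B C := by simp only [inner_eq_toLp, map_add, inner_add_left]
  smul_left A B c := by simp only [inner_eq_toLp, map_smul, inner_smul_left]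
  definite A h := by
    rw [inner_eq_toLp, inner_self_eq_zero] at h
    exact toLp_injective (h.trans (map_zero _).symm)

instance : NormedAddCommGroup (HS K) :=
  InnerProductSpace.Core.toNormedAddCommGroup (cd := core (K := K))
instance : InnerProductSpace ℂ (HS K) := InnerProductSpace.ofCore (core (K := K)).toCore

theorem norm_toLp (A : HS K) : ‖toLp A‖ = ‖A‖ := by
  rw [@norm_eq_sqrt_re_inner ℂ, @norm_eq_sqrt_re_inner ℂ, ← inner_eq_toLp]

theorem ofReal_tsum_norm_sq {ι : Type*} (b : HilbertBasis ι ℂ K) (A : HS K) :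
    ENNReal.ofReal (∑' i, ‖A.op (b i)‖ ^ 2) = ∑' i, ‖A.op (b i)‖ₑ ^ 2 := by
  rw [ENNReal.ofReal_tsum_of_nonneg (fun i => by positivity) ((isHS_iff b _).1 A.isHS)]
  simp [ENNReal.ofReal_pow, ofReal_norm]

theorem hasSum_norm_sq {ι : Type*} (b : HilbertBasis ι ℂ K) (A : HS K) :
    HasSum (fun i => ‖A.op (b i)‖ ^ 2) (‖A‖ ^ 2) := by
  have h1 : ‖A‖ ^ 2 = ∑' i, ‖A.op (refBasis K i)‖ ^ 2 := by
    rw [← norm_toLp]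
    have := lp.norm_rpow_eq_tsum (p := 2) (by norm_num) (toLp A)
    simpa using this
  have h2 : ∑' i, ‖A.op (b i)‖ ^ 2 = ‖A‖ ^ 2 := by
    have h3 := ofReal_tsum_norm_sq b A
    have h4 := ofReal_tsum_norm_sq (refBasis K) A
    rw [tsum_enorm_sq_adjoint b (refBasis K)] at h3
    rw [tsum_enorm_sq_adjoint (refBasis K) (refBasis K), ← h3] at h4
    rw [h1]
    exact ((ENNReal.ofReal_eq_ofReal_iff (tsum_nonneg fun i => by positivity)
      (tsum_nonneg fun i => by positivity)).1 h4).symm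
  rw [← h2]
  exact ((isHS_iff b _).1 A.isHS).hasSum

/-- The Hilbert–Schmidt inner product does not depend on the orthonormal basis. -/
theorem hasSum_inner {ι : Type*} (b : HilbertBasis ι ℂ K) (A B : HS K) :
    HasSum (fun i => inner ℂ (A.op (b i)) (B.op (b i))) (inner ℂ A B) := by
  have h (C : HS K) := Complex.hasSum_ofReal.2 (hasSum_norm_sq b C)
  have h2 := (((h (A + B)).sub (h (A - B))).add
    (((h (A - Complex.I • B)).sub (h (A + Complex.I • B))).mul_right Complex.I)).div_const 4
  have e1 : (inner ℂ A B : ℂ) = ((‖A + B‖ ^ 2 : ℝ) - (‖A - B‖ ^ 2 : ℝ)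
      + ((‖A - Complex.I • B‖ ^ 2 : ℝ) - (‖A + Complex.I • B‖ ^ 2 : ℝ)) * Complex.I) / 4 := by
    rw [inner_eq_sum_norm_sq_div_four A B]; push_cast; rfl
  rw [e1]
  refine h2.congr_fun fun i => ?_
  rw [inner_eq_sum_norm_sq_div_four (A.op (b i)) (B.op (b i))]
  simp

/-- The rank one operator `|x⟩⟨y|`, that is `z ↦ ⟨y, z⟩ x`. -/
def ketBra (x y : K) : HS K := mk (InnerProductSpace.rankOne ℂ x y) (by
  have h := (hasSum_norm_inner_sq (refBasis K) y).summable.mul_right (‖x‖ ^ 2)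
  refine h.congr fun i => ?_
  rw [InnerProductSpace.rankOne_apply, norm_smul, mul_pow, norm_inner_symm])

theorem ketBra_apply (x y z : K) : (ketBra x y).op z = inner ℂ y z • x := rfl

theorem inner_ketBra (x y : K) (A : HS K) : inner ℂ (ketBra x y) A = inner ℂ x (A.op y) := by
  refine (hasSum_inner (refBasis K) (ketBra x y) A).unique ?_
  have h := (((refBasis K).hasSum_repr y).mapL A.op).mapL (innerSL ℂ x)
  refine h.congr_fun fun i => ?_
  simp [ketBra_apply, HilbertBasis.repr_apply_apply, mul_comm]

theorem norm_op_apply_le (A : HS K) (x : K) : ‖A.op x‖ ≤ ‖A‖ * ‖x‖ := by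
  rcases eq_or_ne (A.op x) 0 with h0 | h0
  · rw [h0, norm_zero]; positivity
  have h1 : ‖ketBra (A.op x) x‖ = ‖A.op x‖ * ‖x‖ := by
    have h2 : ‖ketBra (A.op x) x‖ ^ 2 = (‖A.op x‖ * ‖x‖) ^ 2 := by
      have h3 : ((‖ketBra (A.op x) x‖ ^ 2 : ℝ) : ℂ) = ((‖A.op x‖ * ‖x‖) ^ 2 : ℝ) := by
        have := inner_ketBra (A.op x) x (ketBra (A.op x) x)
        rw [ketBra_apply, inner_smul_right, inner_self_eq_norm_sq_to_K,
          inner_self_eq_norm_sq_to_K, inner_self_eq_norm_sq_to_K] at this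
        push_cast
        exact this.trans (mul_comm _ _) |>.trans (mul_pow _ _ _).symm
      exact_mod_cast h3
    exact (sq_eq_sq₀ (by positivity) (by positivity)).1 h2
  have h2 := norm_inner_le_norm (𝕜 := ℂ) (ketBra (A.op x) x) A
  rw [inner_ketBra, h1, inner_self_eq_norm_sq_to_K] at h2
  have h3 : ‖A.op x‖ * ‖A.op x‖ ≤ ‖A.op x‖ * (‖A‖ * ‖x‖) := by
    simp only [norm_pow, RCLike.norm_ofReal, abs_norm] at h2
    nlinarith
  exact le_of_mul_le_mul_left h3 (norm_pos_iff.2 h0)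

instance : CompleteSpace (HS K) := by
  refine Metric.complete_of_cauchySeq_tendsto fun w hw => ?_
  have hop : ∀ A : HS K, ‖A.op‖ ≤ 1 * ‖A‖ := fun A => by
    rw [one_mul]
    exact A.op.opNorm_le_bound (norm_nonneg _) (norm_op_apply_le A)
  let opL : HS K →L[ℂ] (K →L[ℂ] K) := LinearMap.mkContinuous op 1 hop
  let lpL : HS K →ₗᵢ[ℂ] lp (fun _ : refIndex K => K) 2 := ⟨toLp, norm_toLp⟩
  obtain ⟨T, hT⟩ := cauchySeq_tendsto_of_complete (opL.uniformContinuous.comp_cauchySeq hw)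
  obtain ⟨f, hf⟩ := cauchySeq_tendsto_of_complete 
    (lpL.isometry.uniformContinuous.comp_cauchySeq hw)
  have hfT : ∀ i, f i = T (refBasis K i) := by
    intro i
    have h1 : Filter.Tendsto (fun n => (lpL (w n)) i) Filter.atTop (nhds (f i)) :=
      ((lp.evalCLM ℂ (fun _ : refIndex K => K) 2 i).continuous.tendsto f).comp hf
    have h2 : Filter.Tendsto (fun n => opL (w n) (refBasis K i)) Filter.atTop
        (nhds (T (refBasis K i))) :=
      ((ContinuousLinearMap.apply ℂ K (refBasis K i)).continuous.tendsto T).comp hT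
    exact tendsto_nhds_unique h1 h2
  have hTHS : IsHS T := by
    rw [isHS_memℓp]
    have h : (fun i => T (refBasis K i)) = f := funext fun i => (hfT i).symm
    rw [h]
    exact f.2
  refine ⟨mk T hTHS, ?_⟩
  rw [lpL.isometry.isEmbedding.tendsto_nhds_iff]
  convert hf using 2
  ext i
  exact (hfT i).symm

/-- The product `X A` of a bounded and a Hilbert–Schmidt operator. -/
def lmul (X : K →L[ℂ] K) (A : HS K) : HS K := mk (X * A.op) (A.isHS.mul_left X)

/-- The product `A X` of a Hilbert–Schmidt and a bounded operator. -/
def rmul (A : HS K) (X : K →L[ℂ] K) : HS K := mk (A.op * X) (A.isHS.mul_right X)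

@[simp] theorem op_lmul (X : K →L[ℂ] K) (A : HS K) : (lmul X A).op = X * A.op := rfl
@[simp] theorem op_rmul (A : HS K) (X : K →L[ℂ] K) : (rmul A X).op = A.op * X := rfl

end HS

/-! ### States -/

variable (K)

/-- A state: a positive (trace class) operator with `tr ρ = ∑ i, ⟨eᵢ, ρ eᵢ⟩ = 1`. -/
structure DensityOperator where
  /-- The operator itself. -/
  op : K →L[ℂ] K
  isPositive : op.IsPositive
  trace_eq_one : HasSum (fun i => inner ℂ (refBasis K i) (op (refBasis K i))) 1

variable {K}

namespace DensityOperator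

theorem sqrt_isPositive (ρ : DensityOperator K) : (CFC.sqrt ρ.op).IsPositive :=
  (ContinuousLinearMap.nonneg_iff_isPositive _).1 (CFC.sqrt_nonneg _)

theorem sqrt_mul_sqrt (ρ : DensityOperator K) : CFC.sqrt ρ.op * CFC.sqrt ρ.op = ρ.op :=
  CFC.sqrt_mul_sqrt_self _ ((ContinuousLinearMap.nonneg_iff_isPositive _).2 ρ.isPositive)

theorem inner_op_self (ρ : DensityOperator K) (x : K) :
    inner ℂ x (ρ.op x) = ((‖CFC.sqrt ρ.op x‖ ^ 2 : ℝ) : ℂ) := by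
  rw [← ρ.sqrt_mul_sqrt, mul_apply_eq_comp,
    ← ContinuousLinearMap.adjoint_inner_left, ρ.sqrt_isPositive.isSelfAdjoint.adjoint_eq,
    inner_self_eq_norm_sq_to_K, ρ.sqrt_mul_sqrt]
  push_cast; rfl

theorem sqrt_isHS (ρ : DensityOperator K) : IsHS (CFC.sqrt ρ.op) := by
  have h := ρ.trace_eq_one.summable
  simp only [inner_op_self] at h
  exact Complex.summable_ofReal.1 h

/-- `√ρ`, the positive square root, which is a Hilbert–Schmidt operator. -/
def sqrt (ρ : DensityOperator K) : HS K := HS.mk (CFC.sqrt ρ.op) ρ.sqrt_isHS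

@[simp] theorem op_sqrt (ρ : DensityOperator K) : ρ.sqrt.op = CFC.sqrt ρ.op := rfl

/-- The trace can be computed in any orthonormal basis. -/
theorem hasSum_trace {ι : Type*} (b : HilbertBasis ι ℂ K) (ρ : DensityOperator K) :
    HasSum (fun i => inner ℂ (b i) (ρ.op (b i))) 1 := by
  have h1 := ρ.trace_eq_one
  simp only [inner_op_self] at h1 ⊢
  have h2 := Complex.hasSum_ofReal.2 (HS.hasSum_norm_sq (refBasis K) ρ.sqrt)
  rw [h1.unique h2]
  exact Complex.hasSum_ofReal.2 (HS.hasSum_norm_sq b ρ.sqrt)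

/-- `Π_σ`, the orthogonal projection onto the support `(ker σ)ᗮ` of `σ`. -/
def supportProj (σ : DensityOperator K) : K →L[ℂ] K := (σ.op.ker)ᗮ.starProjection

theorem sqrt_apply_eq_zero (σ : DensityOperator K) {x : K} :
    CFC.sqrt σ.op x = 0 ↔ σ.op x = 0 := by
  constructor
  · intro h
    rw [← σ.sqrt_mul_sqrt, mul_apply_eq_comp, h, map_zero]
  · intro h
    have h1 := σ.inner_op_self x
    rw [h, inner_zero_right] at h1
    have h2 : ‖CFC.sqrt σ.op x‖ ^ 2 = 0 := by exact_mod_cast h1.symm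
    simpa using h2

theorem inner_sqrt (σ : DensityOperator K) (x y : K) :
    inner ℂ (CFC.sqrt σ.op x) y = inner ℂ x (CFC.sqrt σ.op y) := by
  rw [← ContinuousLinearMap.adjoint_inner_right, σ.sqrt_isPositive.isSelfAdjoint.adjoint_eq]

theorem inner_supportProj (σ : DensityOperator K) (x y : K) :
    inner ℂ (σ.supportProj x) y = inner ℂ x (σ.supportProj y) :=
  Submodule.inner_starProjection_left_eq_right _ _ _

theorem supportProj_eq_zero (σ : DensityOperator K) {x : K} :
    σ.supportProj x = 0 ↔ σ.op x = 0 := by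
  rw [supportProj, Submodule.starProjection_apply_eq_zero_iff,
    Submodule.orthogonal_orthogonal_eq_closure,
    (σ.op.isClosed_ker).submodule_topologicalClosure_eq]
  rfl

theorem supportProj_idem (σ : DensityOperator K) (x : K) :
    σ.supportProj (σ.supportProj x) = σ.supportProj x :=
  Submodule.starProjection_eq_self_iff.2 (Submodule.starProjection_apply_mem _ _)

theorem sqrt_supportProj (σ : DensityOperator K) (x : K) :
    CFC.sqrt σ.op (σ.supportProj x) = CFC.sqrt σ.op x := by
  have h : CFC.sqrt σ.op (σ.supportProj x - x) = 0 := by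
    rw [sqrt_apply_eq_zero, ← supportProj_eq_zero, map_sub, supportProj_idem, sub_self]
  rwa [map_sub, sub_eq_zero] at h

theorem supportProj_sqrt (σ : DensityOperator K) (x : K) :
    σ.supportProj (CFC.sqrt σ.op x) = CFC.sqrt σ.op x := by
  refine ext_inner_right ℂ fun w => ?_
  rw [inner_supportProj, inner_sqrt, sqrt_supportProj, inner_sqrt]

end DensityOperator

/-! ### The relative modular operator

The operators `S`, its closure and its adjoint are given by their graphs; the theorems
`tomitaGraph_single`, `closure_tomitaGraph_single`, `adjointGraph_single` and
`graph_relativeModular` show that they are (single-valued) operators. -/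

/-- The graph of the antilinear operator `S (X √σ + Y (1 - Π_σ)) = Π_σ X† √ρ`, with domain
`D(S) = {X √σ : X bounded} + {Y (1 - Π_σ) : Y Hilbert–Schmidt}`. -/
def tomitaGraph (ρ σ : DensityOperator K) : Set (HS K × HS K) :=
  {p | ∃ (X : K →L[ℂ] K) (Y : HS K),
    p.1 = HS.lmul X σ.sqrt + HS.rmul Y (1 - σ.supportProj) ∧
    p.2 = HS.lmul (σ.supportProj * X.adjoint) ρ.sqrt}

/-- The graph of the adjoint of an antilinear operator with graph `G`: the pairs `(a, a')` with
`⟨a, S b⟩ = conj ⟨a', b⟩` for all `b ∈ D(S)`. -/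
def adjointGraph (G : Set (HS K × HS K)) : Set (HS K × HS K) :=
  {p | ∀ q ∈ G, inner ℂ p.1 q.2 = conj (inner ℂ p.2 q.1)}

theorem mem_tomitaGraph (ρ σ : DensityOperator K) (X : K →L[ℂ] K) (Y : HS K) :
    (HS.lmul X σ.sqrt + HS.rmul Y (1 - σ.supportProj),
      HS.lmul (σ.supportProj * X.adjoint) ρ.sqrt) ∈ tomitaGraph ρ σ := ⟨X, Y, rfl, rfl⟩

/-- The domain of `S` is dense. -/
theorem eq_zero_of_inner_dom (ρ σ : DensityOperator K) (z : HS K)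
    (hz : ∀ q ∈ tomitaGraph ρ σ, inner ℂ q.1 z = 0) : z = 0 := by
  have h1 : ∀ y, z.op (CFC.sqrt σ.op y) = 0 := by
    intro y
    have h := hz _ (mem_tomitaGraph ρ σ
      (InnerProductSpace.rankOne ℂ (z.op (CFC.sqrt σ.op y)) y) 0)
    have h2 : HS.lmul (InnerProductSpace.rankOne ℂ (z.op (CFC.sqrt σ.op y)) y) σ.sqrt
        + HS.rmul 0 (1 - σ.supportProj)
        = HS.ketBra (z.op (CFC.sqrt σ.op y)) (CFC.sqrt σ.op y) := by
      ext w
      simp [HS.ketBra_apply, σ.inner_sqrt]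
    rw [h2, HS.inner_ketBra] at h
    exact inner_self_eq_zero.1 h
  have h3 : ∀ y, z.op (y - σ.supportProj y) = 0 := by
    intro y
    have h := hz _ (mem_tomitaGraph ρ σ 0 (HS.ketBra (z.op (y - σ.supportProj y)) y))
    have h2 : HS.lmul 0 σ.sqrt
        + HS.rmul (HS.ketBra (z.op (y - σ.supportProj y)) y) (1 - σ.supportProj)
        = HS.ketBra (z.op (y - σ.supportProj y)) (y - σ.supportProj y) := by
      ext w
      simp [HS.ketBra_apply, σ.inner_supportProj]
    rw [h2, HS.inner_ketBra] at h
    exact inner_self_eq_zero.1 h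
  ext x
  have h4 : z.op x = z.op (σ.supportProj x) := by
    have := h3 x
    rwa [map_sub, sub_eq_zero] at this
  have h5 : ∀ w, σ.supportProj (z.op.adjoint w) = 0 := by
    intro w
    rw [σ.supportProj_eq_zero, ← σ.sqrt_apply_eq_zero]
    refine ext_inner_right ℂ fun y => ?_
    rw [σ.inner_sqrt, ContinuousLinearMap.adjoint_inner_left, h1]
    simp
  rw [h4]
  refine ext_inner_left ℂ fun w => ?_
  rw [← ContinuousLinearMap.adjoint_inner_left, ← σ.inner_supportProj, h5]
  simp

/-- The domain of the adjoint of `S` is dense. -/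
theorem eq_zero_of_inner_dom_adjoint (ρ σ : DensityOperator K) (z : HS K)
    (hz : ∀ p ∈ adjointGraph (tomitaGraph ρ σ), inner ℂ p.1 z = 0) : z = 0 := by
  have h1 : ∀ x, CFC.sqrt σ.op (z.op x) = 0 := by
    intro x
    refine ext_inner_left ℂ fun y => ?_
    have h := hz (HS.ketBra (CFC.sqrt σ.op y) x, HS.ketBra (CFC.sqrt ρ.op x) (σ.supportProj y)) (by
      rintro ⟨a, b⟩ ⟨X, Y, rfl, rfl⟩
      simp only [HS.inner_ketBra, inner_conj_symm]
      simp only [HS.op_lmul, mul_apply_eq_comp, DensityOperator.op_sqrt, map_add,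
        HS.op_rmul, add_apply, sub_apply, one_apply_eq_self, σ.supportProj_idem, sub_self,
        map_zero, add_zero, σ.sqrt_supportProj]
      rw [← σ.inner_supportProj, ContinuousLinearMap.adjoint_inner_right,
        σ.supportProj_sqrt])
    rw [HS.inner_ketBra, σ.inner_sqrt] at h
    simpa using h
  have h2 : ∀ x, z.op x = σ.supportProj (z.op x) := by
    intro x
    refine ext_inner_left ℂ fun y => ?_
    have h := hz (HS.ketBra (y - σ.supportProj y) x, 0) (by
      rintro ⟨a, b⟩ ⟨X, Y, rfl, rfl⟩
      simp [HS.inner_ketBra, σ.inner_supportProj, σ.supportProj_idem])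
    rw [HS.inner_ketBra, inner_sub_left, sub_eq_zero, σ.inner_supportProj] at h
    exact h
  ext x
  rw [h2, σ.supportProj_eq_zero.2 (σ.sqrt_apply_eq_zero.1 (h1 x))]
  simp

/-- The adjoint of `S` is single-valued. -/
theorem adjointGraph_single (ρ σ : DensityOperator K) {a b c : HS K}
    (hb : (a, b) ∈ adjointGraph (tomitaGraph ρ σ))
    (hc : (a, c) ∈ adjointGraph (tomitaGraph ρ σ)) : b = c := by
  refine sub_eq_zero.1 (eq_zero_of_inner_dom ρ σ _ fun q hq => ?_)
  have h := (hb q hq).symm.trans (hc q hq)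
  simp only [inner_conj_symm] at h
  rw [inner_sub_right, h, sub_self]

theorem closure_adjointGraph {G : Set (HS K × HS K)} {p q : HS K × HS K}
    (hp : p ∈ adjointGraph G) (hq : q ∈ closure G) :
    inner ℂ p.1 q.2 = conj (inner ℂ p.2 q.1) := by
  have hcl : IsClosed {q : HS K × HS K | inner ℂ p.1 q.2 = conj (inner ℂ p.2 q.1)} :=
    isClosed_eq (by fun_prop) (Complex.continuous_conj.comp (by fun_prop))
  exact closure_minimal (fun q hq => hp q hq) hcl hq

/-- `S` is closable: the closure of its graph is the graph of an operator. -/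
theorem closure_tomitaGraph_single (ρ σ : DensityOperator K) {a b c : HS K}
    (hb : (a, b) ∈ closure (tomitaGraph ρ σ)) (hc : (a, c) ∈ closure (tomitaGraph ρ σ)) :
    b = c := by
  refine sub_eq_zero.1 (eq_zero_of_inner_dom_adjoint ρ σ _ fun p hp => ?_)
  have h := (closure_adjointGraph hp hb).trans (closure_adjointGraph hp hc).symm
  simp only at h
  rw [inner_sub_right, h, sub_self]

/-- `S` is well defined. -/
theorem tomitaGraph_single (ρ σ : DensityOperator K) {a b c : HS K}
    (hb : (a, b) ∈ tomitaGraph ρ σ) (hc : (a, c) ∈ tomitaGraph ρ σ) : b = c :=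
  closure_tomitaGraph_single ρ σ (subset_closure hb) (subset_closure hc)

theorem tomitaGraph_add (ρ σ : DensityOperator K) {p q : HS K × HS K}
    (hp : p ∈ tomitaGraph ρ σ) (hq : q ∈ tomitaGraph ρ σ) : p + q ∈ tomitaGraph ρ σ := by
  obtain ⟨X, Y, h1, h2⟩ := hp
  obtain ⟨X', Y', h1', h2'⟩ := hq
  refine ⟨X + X', Y + Y', ?_, ?_⟩
  · ext w
    simp [h1, h1']
    abel
  · ext w
    simp [h2, h2']

/-- `S` is antilinear. -/
theorem tomitaGraph_smul (ρ σ : DensityOperator K) (c : ℂ) {p : HS K × HS K}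
    (hp : p ∈ tomitaGraph ρ σ) : (c • p.1, conj c • p.2) ∈ tomitaGraph ρ σ := by
  obtain ⟨X, Y, h1, h2⟩ := hp
  refine ⟨c • X, c • Y, ?_, ?_⟩
  · ext w
    simp [h1]
  · ext w
    simp [h2, ContinuousLinearMap.adjoint.map_smulₛₗ]

/-- The graph of `S† S̄`: the pairs `(a, c)` such that `S̄ a = b` and `S† b = c` for some `b`. -/
def modularGraph (ρ σ : DensityOperator K) : Submodule ℂ (HS K × HS K) where
  carrier := {p | ∃ b, (p.1, b) ∈ closure (tomitaGraph ρ σ) ∧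
    (b, p.2) ∈ adjointGraph (tomitaGraph ρ σ)}
  zero_mem' := ⟨0, subset_closure ⟨0, 0, by ext; simp, by ext; simp⟩, fun q _ => by simp⟩
  add_mem' := by
    rintro p q ⟨b, h1, h2⟩ ⟨b', h1', h2'⟩
    refine ⟨b + b', ?_, fun x hx => ?_⟩
    · exact map_mem_closure₂ (f := fun p q : HS K × HS K => p + q) continuous_add h1 h1'
        fun _ h _ h' => tomitaGraph_add ρ σ h h'
    · have e1 := h2 x hx
      have e2 := h2' x hx
      simp only [Prod.snd_add, inner_add_left, map_add] at *
      rw [e1, e2]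
  smul_mem' := by
    rintro c p ⟨b, h1, h2⟩
    refine ⟨conj c • b, ?_, fun x hx => ?_⟩
    · exact map_mem_closure (f := fun p : HS K × HS K => (c • p.1, conj c • p.2))
        (by fun_prop) h1 fun _ h => tomitaGraph_smul ρ σ c h
    · have e1 := h2 x hx
      simp only [Prod.smul_snd, inner_smul_left, map_mul, Complex.conj_conj] at *
      rw [e1]

/-- The relative modular operator `Δ_{ρ,σ} = S† S̄`, an unbounded linear operator. -/
def relativeModular (ρ σ : DensityOperator K) : HS K →ₗ.[ℂ] HS K :=
  (modularGraph ρ σ).toLinearPMap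

theorem graph_relativeModular (ρ σ : DensityOperator K) :
    (relativeModular ρ σ).graph = modularGraph ρ σ := by
  refine Submodule.toLinearPMap_graph_eq _ ?_
  rintro ⟨a, c⟩ ⟨b, h1, h2⟩ ha
  simp only at ha
  subst ha
  have h0 : ((0 : HS K), (0 : HS K)) ∈ tomitaGraph ρ σ :=
    ⟨0, 0, by ext; simp, by ext; simp⟩
  have hb : b = 0 := closure_tomitaGraph_single ρ σ h1 (subset_closure h0)
  subst hb
  exact adjointGraph_single ρ σ h2 fun q _ => by simp

end RelMod

end

noncomputable section

open scoped ComplexConjugate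

/-! ### Coordinates in a Hilbert basis. -/

namespace HilbertBasis

variable {ι H : Type*} [NormedAddCommGroup H] [InnerProductSpace ℂ H]

/-! In the coordinates `a i j = ⟨u i, A (v j)⟩`, the coefficients of `A` in the basis `|u i⟩⟨v j|`,
every operator involved is diagonal up to a swap of indices. Since `√ρ (u i) = √(r i) u i`, `√σ (v
j) = √(s j) v j`, and `Π_σ` keeps or kills `v j` according to whether `s j ≠ 0`, the operator `S`
sends `|u i⟩⟨v j|` to `√(r i / s j) |v j⟩⟨u i|`, where the factor is `0` when `s j = 0`.

Hence `S` obeys the entrywise relation `b j i = √(r i / s j) conj (a i j)`. The closure is exactly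
the set of all pairs obeying it (`mem_closure_tomitaGraph_iff`): the relation is a closed condition,
and basis expansions approximate any such pair from within the graph. The adjoint is given by the
same weights with the two bases exchanged (`mem_adjointGraph_tomitaGraph_iff`), by Parseval.

Composing the two, the conjugations cancel and the weights square, so `Δ` is multiplication by `r i
/ s j` on its maximal domain (`mem_graph_relativeModular_iff`). The action, the domain and the
kernel are read off from this. -/

theorem ext_inner (b : HilbertBasis ι ℂ H) {x y : H}
    (h : ∀ i, inner ℂ (b i) x = inner ℂ (b i) y) : x = y := by
  refine b.repr.injective ?_
  ext i
  rw [b.repr_apply_apply, b.repr_apply_apply, h]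

theorem summable_norm_inner_sq (b : HilbertBasis ι ℂ H) (x : H) :
    Summable fun i => ‖inner ℂ (b i) x‖ ^ 2 := by
  have h := (lp.memℓp (b.repr x)).summable (by norm_num)
  simpa [b.repr_apply_apply] using h

/-- Every square summable family is the family of coefficients of a vector. -/
theorem exists_inner_eq (b : HilbertBasis ι ℂ H) {f : ι → ℂ}
    (hf : Summable fun i => ‖f i‖ ^ 2) : ∃ x, ∀ i, inner ℂ (b i) x = f i := by
  have hm : Memℓp f 2 := by
    rw [memℓp_gen_iff (by norm_num)]
    simpa using hf
  refine ⟨b.repr.symm ⟨f, hm⟩, fun i => ?_⟩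
  rw [← b.repr_apply_apply, LinearIsometryEquiv.apply_symm_apply]

theorem hasSum_inner_smul (b : HilbertBasis ι ℂ H) (x : H) :
    HasSum (fun i => inner ℂ (b i) x • b i) x := by
  simpa [b.repr_apply_apply] using b.hasSum_repr x

end HilbertBasis

namespace RelMod

/-! ### The rank one basis of the Hilbert–Schmidt space. -/

section Basis

variable {K : Type*} [NormedAddCommGroup K] [InnerProductSpace ℂ K] [CompleteSpace K]
  {ι κ : Type*}

/-- The rank one operators `|u i⟩⟨v j|` form an orthonormal basis of `HS K`. -/
def ketBraBasis (u : HilbertBasis ι ℂ K) (v : HilbertBasis κ ℂ K) :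
    HilbertBasis (ι × κ) ℂ (HS K) :=
  HilbertBasis.mkOfOrthogonalEqBot (v := fun p : ι × κ => HS.ketBra (u p.1) (v p.2))
    (by
      classical
      rw [orthonormal_iff_ite]
      rintro ⟨i, j⟩ ⟨k, l⟩
      rw [HS.inner_ketBra, HS.ketBra_apply, inner_smul_right,
        orthonormal_iff_ite.1 u.orthonormal, orthonormal_iff_ite.1 v.orthonormal]
      by_cases h1 : i = k <;> by_cases h2 : j = l <;> simp [h1, h2, eq_comm])
    (by
      rw [Submodule.eq_bot_iff]
      intro A hA
      -- Pairing `A` with a rank one operator gives a matrix entry, so an `A` orthogonal to all of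
      -- them kills every `v j`.
      have h : ∀ i j, inner ℂ (u i) (A.op (v j)) = 0 := fun i j => by
        rw [← HS.inner_ketBra]
        exact hA _ (Submodule.subset_span ⟨(i, j), rfl⟩)
      ext1
      refine ContinuousLinearMap.ext_on
        (Submodule.dense_iff_topologicalClosure_eq_top.2 v.dense_span) ?_
      rintro _ ⟨j, rfl⟩
      refine u.ext_inner fun i => ?_
      rw [h, map_zero, zero_apply, inner_zero_right])

@[simp] theorem ketBraBasis_apply (u : HilbertBasis ι ℂ K) (v : HilbertBasis κ ℂ K)
    (p : ι × κ) : ketBraBasis u v p = HS.ketBra (u p.1) (v p.2) := by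
  simp [ketBraBasis]

end Basis

/-! ### Eigenvectors of a state, of its square root and of its support projection. -/

namespace DensityOperator

variable {K : Type*} [NormedAddCommGroup K] [InnerProductSpace ℂ K] [CompleteSpace K]
  {ι : Type*}

/-- Evaluation at `v j` is continuous for the operator norm, and orthonormality leaves one term of
the series. The coordinate lemmas below take the spectral decomposition in this form. -/
theorem apply_eq_smul_of_hasSum {σ : DensityOperator K} {v : HilbertBasis ι ℂ K} {s : ι → ℝ}
    (hσ : HasSum (fun j => (s j : ℂ) • InnerProductSpace.rankOne ℂ (v j) (v j)) σ.op) (j : ι) :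
    σ.op (v j) = (s j : ℂ) • v j := by
  classical
  have h := hσ.mapL (ContinuousLinearMap.apply ℂ K (v j))
  refine h.unique ?_
  convert hasSum_ite_eq j ((s j : ℂ) • v j) using 2 with k
  simp only [ContinuousLinearMap.apply_apply, smul_apply, InnerProductSpace.rankOne_apply,
    orthonormal_iff_ite.1 v.orthonormal]
  split_ifs with hk <;> simp [hk]

/-- An eigenvector of `σ` is an eigenvector of `√σ`. -/
theorem sqrt_apply_of_apply_eq_smul (σ : DensityOperator K) {x : K} {s : ℝ} (hs : 0 ≤ s)
    (hx : σ.op x = (s : ℂ) • x) : CFC.sqrt σ.op x = ((√s : ℝ) : ℂ) • x := by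
  rcases hs.eq_or_lt with rfl | hs
  · rw [Real.sqrt_zero, Complex.ofReal_zero, zero_smul, sqrt_apply_eq_zero, hx]
    simp
  -- From `(√σ + √s)(√σ - √s) x = (σ - s) x = 0`, the vector `w` satisfies `√σ w = -√s w`.
  -- Positivity of `√σ` then forces `w = 0`, provided `√s > 0`; this is why `s = 0` was treated
  -- apart.
  set w := CFC.sqrt σ.op x - ((√s : ℝ) : ℂ) • x with hw
  have h1 : CFC.sqrt σ.op w = -(((√s : ℝ) : ℂ) • w) := by
    have h2 : CFC.sqrt σ.op (CFC.sqrt σ.op x) = (s : ℂ) • x := by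
      rw [← mul_apply_eq_comp, sqrt_mul_sqrt, hx]
    rw [hw, map_sub, map_smul, h2, smul_sub, smul_smul, ← Complex.ofReal_mul,
      Real.mul_self_sqrt hs.le]
    abel
  have h3 := σ.sqrt_isPositive.re_inner_nonneg_left w
  rw [h1, inner_neg_left, inner_smul_left, Complex.conj_ofReal, inner_self_eq_norm_sq_to_K] at h3
  have h4 : 0 ≤ -(√s * ‖w‖ ^ 2) := by
    have e : -(((√s : ℝ) : ℂ) * ((‖w‖ : ℝ) : ℂ) ^ 2) = ((-(√s * ‖w‖ ^ 2) : ℝ) : ℂ) := by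
      push_cast
      rfl
    exact (h3.trans_eq (congrArg Complex.re e)).trans_eq (Complex.ofReal_re _)
  have h5 : ‖w‖ ^ 2 = 0 := by
    have := Real.sqrt_pos.2 hs
    nlinarith [sq_nonneg ‖w‖]
  exact sub_eq_zero.1 (norm_eq_zero.1 (pow_eq_zero_iff two_ne_zero |>.1 h5))

/-- By self-adjointness, an eigenvector with nonzero eigenvalue is orthogonal to `ker σ`. The defect
`Π_σ x - x` lies in `ker σ`, so it is orthogonal to `x` as well as to `Π_σ x`, hence to itself. -/
theorem supportProj_apply_of_apply_eq_smul (σ : DensityOperator K) {x : K} {s : ℝ} (hs : s ≠ 0)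
    (hx : σ.op x = (s : ℂ) • x) : σ.supportProj x = x := by
  have h : σ.supportProj (x - σ.supportProj x) = 0 := by
    rw [map_sub, supportProj_idem, sub_self]
  rw [supportProj_eq_zero, map_sub, sub_eq_zero] at h
  have h2 : σ.op (σ.supportProj x - x) = 0 := by rw [map_sub, h, sub_self]
  have h3 : inner ℂ (σ.supportProj x - x) x = 0 := by
    have h4 : (s : ℂ) * inner ℂ (σ.supportProj x - x) x = 0 := by
      rw [← inner_smul_right, ← hx, ← σ.isPositive.isSelfAdjoint.adjoint_eq,
        ContinuousLinearMap.adjoint_inner_right, h2, inner_zero_left]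
    exact (mul_eq_zero.1 h4).resolve_left (by exact_mod_cast hs)
  have h5 : inner ℂ (σ.supportProj x - x) (σ.supportProj x) = 0 := by
    rw [← σ.inner_supportProj, map_sub, supportProj_idem, sub_self, inner_zero_left]
  have h6 : inner ℂ (σ.supportProj x - x) (σ.supportProj x - x) = 0 := by
    rw [inner_sub_right, h5, h3, sub_zero]
  exact sub_eq_zero.1 (inner_self_eq_zero.1 h6)

end DensityOperator

/-! ### `S`, its closure, its adjoint and `Δ` in coordinates. -/

section Modular

variable {K : Type*} [NormedAddCommGroup K] [InnerProductSpace ℂ K] [CompleteSpace K]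
  {ι : Type*} {ρ σ : DensityOperator K} {u v : HilbertBasis ι ℂ K} {r s : ι → ℝ}

/-- For `s j ≠ 0` the `Y` term drops out on `v j`, and the two entries are `√(r i) conj ⟨u i, X (v
j)⟩` and `√(s j) ⟨u i, X (v j)⟩`; their comparison eliminates `X`. -/
theorem inner_ketBra_of_mem_tomitaGraph
    (hr : ∀ i, 0 ≤ r i) (hρ : ∀ i, ρ.op (u i) = (r i : ℂ) • u i)
    (hs : ∀ j, 0 ≤ s j) (hσ : ∀ j, σ.op (v j) = (s j : ℂ) • v j)
    {p : HS K × HS K} (hp : p ∈ tomitaGraph ρ σ) (i j : ι) :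
    inner ℂ (HS.ketBra (v j) (u i)) p.2 =
      ((√(r i / s j) : ℝ) : ℂ) * conj (inner ℂ (HS.ketBra (u i) (v j)) p.1) := by
  obtain ⟨X, Y, h1, h2⟩ := hp
  rw [h1, h2, HS.inner_ketBra, HS.inner_ketBra]
  simp only [map_add, HS.op_lmul, HS.op_rmul, add_apply, mul_apply_eq_comp,
    DensityOperator.op_sqrt, ρ.sqrt_apply_of_apply_eq_smul (hr i) (hρ i),
    σ.sqrt_apply_of_apply_eq_smul (hs j) (hσ j), sub_apply, one_apply_eq_self]
  rw [← σ.inner_supportProj]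
  -- If `s j = 0`, the left side vanishes because `Π_σ (v j) = 0`, and the right side because `r i /
  -- 0 = 0`.
  by_cases h0 : s j = 0
  · have h3 : σ.supportProj (v j) = 0 := by rw [σ.supportProj_eq_zero, hσ, h0]; simp
    simp [h3, h0]
  · have h3 := σ.supportProj_apply_of_apply_eq_smul h0 (hσ j)
    have h4 : √(s j) ≠ 0 := (Real.sqrt_pos.2 ((hs j).lt_of_ne' h0)).ne'
    have h5 : ((√(s j) : ℝ) : ℂ) ≠ 0 := by exact_mod_cast h4
    rw [h3, sub_self, map_zero, add_zero, map_smul, map_smul, inner_smul_right, inner_smul_right,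
      ContinuousLinearMap.adjoint_inner_right, map_mul, inner_conj_symm, Complex.conj_ofReal,
      Real.sqrt_div (hr i)]
    push_cast
    field_simp

/-- Each basis vector lies in the domain of `S` itself, so it can be used both to test the adjoint
and to approximate elements of the closure. -/
theorem ketBra_mem_tomitaGraph
    (hr : ∀ i, 0 ≤ r i) (hρ : ∀ i, ρ.op (u i) = (r i : ℂ) • u i)
    (hs : ∀ j, 0 ≤ s j) (hσ : ∀ j, σ.op (v j) = (s j : ℂ) • v j) (i j : ι) :
    (HS.ketBra (u i) (v j), ((√(r i / s j) : ℝ) : ℂ) • HS.ketBra (v j) (u i))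
      ∈ tomitaGraph ρ σ := by
  have hρ' := ρ.sqrt_apply_of_apply_eq_smul (hr i) (hρ i)
  have hσ' := σ.sqrt_apply_of_apply_eq_smul (hs j) (hσ j)
  by_cases h0 : s j = 0
  · have h3 : σ.supportProj (v j) = 0 := by rw [σ.supportProj_eq_zero, hσ, h0]; simp
    -- Here `v j` lies in `ker σ`, so `|u i⟩⟨v j| (1 - Π_σ) = |u i⟩⟨v j|` and the `Y` part alone
    -- suffices.
    refine ⟨0, HS.ketBra (u i) (v j), ?_, ?_⟩
    · ext w
      simp [HS.ketBra_apply, ← σ.inner_supportProj, h3]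
    · ext w
      simp [h0]
  · have h3 := σ.supportProj_apply_of_apply_eq_smul h0 (hσ j)
    have h4 : √(s j) ≠ 0 := (Real.sqrt_pos.2 ((hs j).lt_of_ne' h0)).ne'
    have h5 : ((√(s j) : ℝ) : ℂ) ≠ 0 := by exact_mod_cast h4
    -- The scalar compensates for `|u i⟩⟨v j| √σ = √(s j) |u i⟩⟨v j|`.
    refine ⟨(((√(s j))⁻¹ : ℝ) : ℂ) • InnerProductSpace.rankOne ℂ (u i) (v j), 0, ?_, ?_⟩
    · ext w
      simp only [map_add, HS.op_lmul, HS.op_rmul, add_apply, mul_apply_eq_comp, smul_apply,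
        InnerProductSpace.rankOne_apply, HS.ketBra_apply, DensityOperator.op_sqrt, map_zero,
        zero_apply, add_zero]
      rw [← σ.inner_sqrt, hσ', inner_smul_left, smul_smul, Complex.conj_ofReal, ← mul_assoc,
        ← Complex.ofReal_mul, inv_mul_cancel₀ h4]
      simp
    · ext w
      simp only [map_smul, HS.op_lmul, mul_apply_eq_comp, smul_apply, HS.ketBra_apply,
        DensityOperator.op_sqrt, ContinuousLinearMap.adjoint.map_smulₛₗ,
        InnerProductSpace.adjoint_rankOne, InnerProductSpace.rankOne_apply, Complex.conj_ofReal]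
      rw [← ρ.inner_sqrt, hρ', inner_smul_left, h3, smul_smul, smul_smul, Complex.conj_ofReal,
        Real.sqrt_div (hr i)]
      congr 1
      push_cast
      field_simp

/-- `S̄` in coordinates. -/
theorem mem_closure_tomitaGraph_iff
    (hr : ∀ i, 0 ≤ r i) (hρ : ∀ i, ρ.op (u i) = (r i : ℂ) • u i)
    (hs : ∀ j, 0 ≤ s j) (hσ : ∀ j, σ.op (v j) = (s j : ℂ) • v j) {a b : HS K} :
    (a, b) ∈ closure (tomitaGraph ρ σ) ↔ ∀ i j, inner ℂ (HS.ketBra (v j) (u i)) b =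
      ((√(r i / s j) : ℝ) : ℂ) * conj (inner ℂ (HS.ketBra (u i) (v j)) a) := by
  constructor
  · intro h i j
    have hcl : IsClosed {p : HS K × HS K | inner ℂ (HS.ketBra (v j) (u i)) p.2 =
        ((√(r i / s j) : ℝ) : ℂ) * conj (inner ℂ (HS.ketBra (u i) (v j)) p.1)} :=
      isClosed_eq (by fun_prop)
        (continuous_const.mul (Complex.continuous_conj.comp (by fun_prop)))
    exact closure_minimal (fun p hp => inner_ketBra_of_mem_tomitaGraph hr hρ hs hσ hp i j) hcl h
  · intro h
    have ha := (ketBraBasis u v).hasSum_inner_smul a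
    -- The swap indexes both expansions by the same pairs `(i, j)`. Partial sums over a common
    -- finite set are then sums of scaled pairs from `ketBra_mem_tomitaGraph`, and these stay in the
    -- graph by antilinearity.
    have hb := (Equiv.prodComm ι ι).hasSum_iff.2 ((ketBraBasis v u).hasSum_inner_smul b)
    refine mem_closure_of_tendsto (ha.prodMk hb) (Filter.Eventually.of_forall fun t => ?_)
    induction t using Finset.cons_induction with
    | empty => exact ⟨0, 0, by ext; simp, by ext; simp⟩
    | cons p t hp ih =>
      rw [Finset.sum_cons]
      refine tomitaGraph_add ρ σ ?_ ih
      convert tomitaGraph_smul ρ σ (inner ℂ (HS.ketBra (u p.1) (v p.2)) a)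
        (ketBra_mem_tomitaGraph hr hρ hs hσ p.1 p.2) using 2
      · simp
      · simp only [Function.comp_apply, Equiv.prodComm_apply, ketBraBasis_apply, Prod.fst_swap,
          Prod.snd_swap, h, smul_smul]
        rw [mul_comm]

/-- `S†` in coordinates. -/
theorem mem_adjointGraph_tomitaGraph_iff
    (hr : ∀ i, 0 ≤ r i) (hρ : ∀ i, ρ.op (u i) = (r i : ℂ) • u i)
    (hs : ∀ j, 0 ≤ s j) (hσ : ∀ j, σ.op (v j) = (s j : ℂ) • v j) {b c : HS K} :
    (b, c) ∈ adjointGraph (tomitaGraph ρ σ) ↔ ∀ i j, inner ℂ (HS.ketBra (u i) (v j)) c =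
      ((√(r i / s j) : ℝ) : ℂ) * conj (inner ℂ (HS.ketBra (v j) (u i)) b) := by
  constructor
  · intro h i j
    have h1 := h _ (ketBra_mem_tomitaGraph hr hρ hs hσ i j)
    simp only [inner_smul_right, inner_conj_symm] at h1 ⊢
    exact h1.symm
  · rintro h ⟨x, y⟩ hq
    -- Expand `⟨b, y⟩` and `⟨x, c⟩` by Parseval in the two bases; after the swap, the series agree
    -- term by term.
    have hy := (ketBraBasis v u).hasSum_inner_mul_inner b y
    have hx := (Equiv.prodComm ι ι).hasSum_iff.2
      ((ketBraBasis u v).hasSum_inner_mul_inner x c)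
    rw [inner_conj_symm]
    refine hy.unique (hx.congr_fun fun p => ?_)
    have h1 := inner_ketBra_of_mem_tomitaGraph hr hρ hs hσ hq p.2 p.1
    simp only [ketBraBasis_apply, Function.comp_apply, Equiv.prodComm_apply, Prod.fst_swap,
      Prod.snd_swap, h1, h, inner_conj_symm]
    ring

/-- `Δ = S† S̄` in coordinates: it is diagonal with the eigenvalues `r i / s j`, where
`r i / 0 = 0`. -/
theorem mem_graph_relativeModular_iff
    (hr : ∀ i, 0 ≤ r i) (hρ : ∀ i, ρ.op (u i) = (r i : ℂ) • u i)
    (hs : ∀ j, 0 ≤ s j) (hσ : ∀ j, σ.op (v j) = (s j : ℂ) • v j) {a c : HS K} :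
    (a, c) ∈ (relativeModular ρ σ).graph ↔ ∀ i j, inner ℂ (HS.ketBra (u i) (v j)) c =
      ((r i / s j : ℝ) : ℂ) * inner ℂ (HS.ketBra (u i) (v j)) a := by
  have hsq : ∀ i j, (√(r i / s j) : ℂ) * (√(r i / s j) : ℂ) = ((r i / s j : ℝ) : ℂ) :=
    fun i j => by rw [← Complex.ofReal_mul, Real.mul_self_sqrt (div_nonneg (hr i) (hs j))]
  rw [graph_relativeModular]
  constructor
  · rintro ⟨b, h1, h2⟩ i j
    rw [mem_closure_tomitaGraph_iff hr hρ hs hσ] at h1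
    rw [mem_adjointGraph_tomitaGraph_iff hr hρ hs hσ] at h2
    rw [h2, h1, map_mul, Complex.conj_conj, Complex.conj_ofReal, ← mul_assoc, hsq]
  · intro h
    -- The intermediate vector `b = S̄ a` must have these coefficients, so they have to be square
    -- summable. With `t = r i / s j`, the inequality `t ≤ 1 + t²` bounds their squares by the sum
    -- of the squared coefficients of `a` and `c`.
    have hsum : Summable fun p : ι × ι => ‖((√(r p.2 / s p.1) : ℝ) : ℂ) *
        conj (inner ℂ (HS.ketBra (u p.2) (v p.1)) a)‖ ^ 2 := by
      have ha := (ketBraBasis u v).summable_norm_inner_sq a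
      have hc := (ketBraBasis u v).summable_norm_inner_sq c
      refine Summable.of_nonneg_of_le (fun p => by positivity) (fun p => ?_)
        ((Equiv.prodComm ι ι).summable_iff.2 (ha.add hc))
      have hn : 0 ≤ r p.2 / s p.1 := div_nonneg (hr _) (hs _)
      have e : ‖inner ℂ (HS.ketBra (u p.2) (v p.1)) c‖ =
          r p.2 / s p.1 * ‖inner ℂ (HS.ketBra (u p.2) (v p.1)) a‖ := by
        rw [h, norm_mul, Complex.norm_real, Real.norm_of_nonneg hn]
      simp only [ketBraBasis_apply, Function.comp_apply, Equiv.prodComm_apply, Prod.fst_swap,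
        Prod.snd_swap, e, norm_mul, RCLike.norm_conj, Complex.norm_real, mul_pow,
        Real.norm_of_nonneg (Real.sqrt_nonneg _), Real.sq_sqrt hn]
      nlinarith [mul_nonneg (sq_nonneg ‖inner ℂ (HS.ketBra (u p.2) (v p.1)) a‖)
        (add_nonneg (sq_nonneg (r p.2 / s p.1 - 1)) (add_nonneg hn zero_le_one)),
        mul_nonneg (sq_nonneg ‖inner ℂ (HS.ketBra (u p.2) (v p.1)) a‖)
          (sq_nonneg (r p.2 / s p.1 - 1)),
        mul_nonneg (sq_nonneg ‖inner ℂ (HS.ketBra (u p.2) (v p.1)) a‖) hn]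
    obtain ⟨b, hb⟩ := (ketBraBasis v u).exists_inner_eq hsum
    have hb' : ∀ i j, inner ℂ (HS.ketBra (v j) (u i)) b =
        ((√(r i / s j) : ℝ) : ℂ) * conj (inner ℂ (HS.ketBra (u i) (v j)) a) := fun i j => by
      simpa using hb (j, i)
    refine ⟨b, (mem_closure_tomitaGraph_iff hr hρ hs hσ).2 hb',
      (mem_adjointGraph_tomitaGraph_iff hr hρ hs hσ).2 fun i j => ?_⟩
    rw [hb', map_mul, Complex.conj_conj, Complex.conj_ofReal, ← mul_assoc, hsq, h]

/-- By Riesz–Fischer, an image with coefficients `(r i / s j) a i j` exists exactly when these are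
square summable. -/
theorem mem_domain_relativeModular_iff
    (hr : ∀ i, 0 ≤ r i) (hρ : ∀ i, ρ.op (u i) = (r i : ℂ) • u i)
    (hs : ∀ j, 0 ≤ s j) (hσ : ∀ j, σ.op (v j) = (s j : ℂ) • v j) {a : HS K} :
    a ∈ (relativeModular ρ σ).domain ↔ Summable fun p : ι × ι =>
      (r p.1 / s p.2) ^ 2 * ‖inner ℂ (HS.ketBra (u p.1) (v p.2)) a‖ ^ 2 := by
  have e : ∀ p : ι × ι, ‖((r p.1 / s p.2 : ℝ) : ℂ) * inner ℂ (HS.ketBra (u p.1) (v p.2)) a‖ ^ 2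
      = (r p.1 / s p.2) ^ 2 * ‖inner ℂ (HS.ketBra (u p.1) (v p.2)) a‖ ^ 2 := fun p => by
    rw [norm_mul, mul_pow, Complex.norm_real, Real.norm_eq_abs, sq_abs]
  rw [LinearPMap.mem_domain_iff]
  constructor
  · rintro ⟨c, hc⟩
    rw [mem_graph_relativeModular_iff hr hρ hs hσ] at hc
    refine ((ketBraBasis u v).summable_norm_inner_sq c).congr fun p => ?_
    rw [ketBraBasis_apply, hc, e]
  · intro h
    obtain ⟨c, hc⟩ := (ketBraBasis u v).exists_inner_eq (h.congr fun p => (e p).symm)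
    refine ⟨c, (mem_graph_relativeModular_iff hr hρ hs hσ).2 fun i j => ?_⟩
    simpa using hc (i, j)

end Modular

end RelMod

end

/-! ### The spectral form and the kernel of `Δ`. -/

theorem propositionB1 {K : Type*} [NormedAddCommGroup K] [InnerProductSpace ℂ K] [CompleteSpace K]
    {ι : Type*} (ρ σ : RelMod.DensityOperator K) (u v : HilbertBasis ι ℂ K) (r s : ι → ℝ)
    (hr : ∀ i, 0 ≤ r i) (hr_sum : HasSum r 1)
    (hρ : HasSum (fun i => (r i : ℂ) • InnerProductSpace.rankOne ℂ (u i) (u i)) ρ.op)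
    (hs : ∀ j, 0 ≤ s j) (hs_sum : HasSum s 1)
    (hσ : HasSum (fun j => (s j : ℂ) • InnerProductSpace.rankOne ℂ (v j) (v j)) σ.op) :
    -- the `X i j = |u i⟩⟨v j|` form an orthonormal basis of the Hilbert–Schmidt operators
    (∃ b : HilbertBasis (ι × ι) ℂ (RelMod.HS K),
      ∀ i j, b (i, j) = RelMod.HS.ketBra (u i) (v j)) ∧
    -- the domain and the action of `Δ = ∑ (r i / s j) |X i j⟩⟨X i j|`
    (∀ A : RelMod.HS K, A ∈ (RelMod.relativeModular ρ σ).domain ↔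
      Summable fun p : {p : ι × ι // r p.1 ≠ 0 ∧ s p.2 ≠ 0} =>
        (r p.1.1 / s p.1.2) ^ 2 *
          ‖inner ℂ (RelMod.HS.ketBra (u p.1.1) (v p.1.2)) A‖ ^ 2) ∧
    (∀ A : (RelMod.relativeModular ρ σ).domain,
      HasSum (fun p : {p : ι × ι // r p.1 ≠ 0 ∧ s p.2 ≠ 0} =>
        ((r p.1.1 / s p.1.2 : ℝ) : ℂ) •
          inner ℂ (RelMod.HS.ketBra (u p.1.1) (v p.1.2)) (A : RelMod.HS K) •
            RelMod.HS.ketBra (u p.1.1) (v p.1.2))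
        (RelMod.relativeModular ρ σ A)) ∧
    -- eigenvectors for the nonzero eigenvalues
    (∀ i j, r i ≠ 0 → s j ≠ 0 →
      ∃ h : RelMod.HS.ketBra (u i) (v j) ∈ (RelMod.relativeModular ρ σ).domain,
        RelMod.relativeModular ρ σ ⟨RelMod.HS.ketBra (u i) (v j), h⟩ =
          ((r i / s j : ℝ) : ℂ) • RelMod.HS.ketBra (u i) (v j)) ∧
    -- the kernel
    (LinearMap.ker (RelMod.relativeModular ρ σ).toFun).map
        (RelMod.relativeModular ρ σ).domain.subtype =
      (Submodule.span ℂ {A : RelMod.HS K | ∃ i j, (r i = 0 ∨ s j = 0) ∧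
        A = RelMod.HS.ketBra (u i) (v j)}).topologicalClosure := by
  have hρ' := RelMod.DensityOperator.apply_eq_smul_of_hasSum hρ
  have hσ' := RelMod.DensityOperator.apply_eq_smul_of_hasSum hσ
  have hgraph {a c : RelMod.HS K} :=
    RelMod.mem_graph_relativeModular_iff (a := a) (c := c) hr hρ' hs hσ'
  -- The weights vanish off the index set of the statement, also for `s j = 0` since division by
  -- zero gives zero. Sums over all pairs may therefore be restricted to that set.
  have hdiv : ∀ p : ι × ι, p ∉ {p : ι × ι | r p.1 ≠ 0 ∧ s p.2 ≠ 0} → r p.1 / s p.2 = 0 := by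
    intro p hp
    rw [div_eq_zero_iff]
    by_contra! h
    exact hp h
  refine ⟨⟨RelMod.ketBraBasis u v, fun i j => by simp⟩, fun A => ?_, fun A => ?_,
    fun i j _ _ => ?_, ?_⟩
  · rw [RelMod.mem_domain_relativeModular_iff hr hρ' hs hσ']
    refine (Subtype.val_injective.summable_iff fun p hp => ?_).symm
    rw [Subtype.range_coe_subtype] at hp
    simp [hdiv p hp]
  · have h := (RelMod.ketBraBasis u v).hasSum_inner_smul (RelMod.relativeModular ρ σ A)
    refine (hasSum_subtype_iff_of_support_subset (f := fun p : ι × ι =>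
      ((r p.1 / s p.2 : ℝ) : ℂ) • inner ℂ (RelMod.HS.ketBra (u p.1) (v p.2)) (A : RelMod.HS K) •
        RelMod.HS.ketBra (u p.1) (v p.2))
      (s := {p | r p.1 ≠ 0 ∧ s p.2 ≠ 0}) fun p hp => ?_).2 (h.congr_fun fun p => ?_)
    · by_contra h
      exact hp (by simp [hdiv p h])
    · rw [RelMod.ketBraBasis_apply, hgraph.1 (LinearPMap.mem_graph _ A), smul_smul]
  · have h : (RelMod.HS.ketBra (u i) (v j), ((r i / s j : ℝ) : ℂ) • RelMod.HS.ketBra (u i) (v j))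
        ∈ (RelMod.relativeModular ρ σ).graph := by
      refine hgraph.2 fun k l => ?_
      have ho := (RelMod.ketBraBasis u v).orthonormal.2 (i := (k, l)) (j := (i, j))
      rw [inner_smul_right]
      by_cases hkl : (k, l) = (i, j)
      · cases hkl
        rfl
      · have ho := ho hkl
        simp only [RelMod.ketBraBasis_apply] at ho
        rw [ho, mul_zero, mul_zero]
    obtain ⟨y, hy, hy'⟩ := (LinearPMap.mem_graph_iff _).1 h
    simp only at hy hy'
    refine ⟨hy ▸ y.2, ?_⟩
    rw [← hy']
    congr 1
    exact Subtype.ext hy.symm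
  -- `A` is in the kernel exactly when `(A, 0)` is in the graph, that is, when its coefficients
  -- vanish wherever the weight does not.
  · have hker : ∀ A : RelMod.HS K,
        A ∈ (LinearMap.ker (RelMod.relativeModular ρ σ).toFun).map
          (RelMod.relativeModular ρ σ).domain.subtype ↔
        ∀ i j, r i ≠ 0 → s j ≠ 0 → inner ℂ (RelMod.HS.ketBra (u i) (v j)) A = 0 := by
      intro A
      have h1 : A ∈ (LinearMap.ker (RelMod.relativeModular ρ σ).toFun).map
          (RelMod.relativeModular ρ σ).domain.subtype ↔
          (A, 0) ∈ (RelMod.relativeModular ρ σ).graph := by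
        rw [LinearPMap.mem_graph_iff, Submodule.mem_map]
        exact exists_congr fun y => and_comm
      rw [h1, hgraph]
      refine forall_congr' fun i => forall_congr' fun j => ?_
      rw [inner_zero_right, eq_comm, mul_eq_zero, Complex.ofReal_eq_zero, div_eq_zero_iff]
      tauto
    refine le_antisymm (fun A hA => ?_) (Submodule.topologicalClosure_minimal _ ?_ ?_)
    -- Only terms with `r i = 0` or `s j = 0` survive in the expansion of `A`, so its partial sums
    -- lie in the span.
    · rw [hker] at hA
      refine mem_closure_of_tendsto ((RelMod.ketBraBasis u v).hasSum_inner_smul A)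
        (Filter.Eventually.of_forall fun t => Submodule.sum_mem _ fun p _ => ?_)
      rw [RelMod.ketBraBasis_apply]
      by_cases hp : r p.1 = 0 ∨ s p.2 = 0
      · exact Submodule.smul_mem _ _ (Submodule.subset_span ⟨p.1, p.2, hp, rfl⟩)
      · push Not at hp
        rw [hA _ _ hp.1 hp.2, zero_smul]
        exact Submodule.zero_mem _
    · rw [Submodule.span_le]
      rintro _ ⟨i, j, hij, rfl⟩
      refine (hker _).2 fun k l hk hl => ?_
      have ho := (RelMod.ketBraBasis u v).orthonormal.2 (i := (k, l)) (j := (i, j)) (by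
        rintro ⟨⟩
        tauto)
      simpa using ho
    -- Although `Δ` may be unbounded, its kernel is closed: it is an intersection of kernels of
    -- continuous functionals.
    · have hset : (((LinearMap.ker (RelMod.relativeModular ρ σ).toFun).map
          (RelMod.relativeModular ρ σ).domain.subtype : Submodule ℂ (RelMod.HS K)) :
          Set (RelMod.HS K)) = ⋂ i, ⋂ j, ⋂ (_ : r i ≠ 0), ⋂ (_ : s j ≠ 0),
            {A | inner ℂ (RelMod.HS.ketBra (u i) (v j)) A = 0} := by
        ext A
        simpa using hker A
      rw [hset]
      exact isClosed_iInter fun i => isClosed_iInter fun j => isClosed_iInter fun _ =>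
        isClosed_iInter fun _ => isClosed_eq (by fun_prop) continuous_const
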